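/- Let $X$ be a real Hilbert space with dual $X^*$ and $F=f+g$ on $X$, where $f:X\to\mathbb R$ is continuously differentiable with Lipschitz continuous derivative $f':X\to X^*$, and $g:X\to\mathbb R$ is lower semicontinuous and satisfies, for some $\kappa_2\in\mathbb R$ (possibly negative), $$g(sx+(1-s)y)\le s\,g(x)+(1-s)\,g(y)-\tfrac{\kappa_2}{2}s(1-s)\|x-y\|^2\qquad(x,y\in X,\ s\in[0,1]).$$ For $\Phi:X\to\mathbb R$ let $\partial_F\Phi(x)=\{\ell\in X^*:\liminf_{y\to x,\,y\ne x}\frac{\Phi(y)-\Phi(x)-\ell(y-x)}{\|y-x\|}\ge 0\}$ be the Fréchet subdifferential; $x$ is called stationary if $0\in\partial_F F(x)$. Inexact Proximal Newton iterates. For a bounded symmetric bilinear form $H_x$ on $X$, $\omega\in\mathbb R$ and $\mu\in X^*$ put $$\lambda_{x,\omega}(d)=f'(x)d+\tfrac12H_x(d,d)+\tfrac{\omega}{2}\|d\|^2+g(x+d)-g(x),\qquad \lambda^{\mu}_{x,\omega}(d)=f'(x)d+\mu d+\tfrac{\omega}{2}\|d\|^2 .$$ Let $\gamma\in(0,1)$,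 $\tilde\omega_{\max}>0$, and let $(x_k)$ satisfy $x_{k+1}=x_k+\Delta s_k$, where for every $k$ there are given $\omega_k\in\mathbb R$, $\eta_k\ge0$ and $\mu_k\in\partial_Fg(x_k)$ such that * $H_{x_k}(v,v)\ge\kappa_1\|v\|^2$ for all $v\in X$, for some $\kappa_1\in\mathbb R$ (which may depend on $k$) with $\omega_k>-(\kappa_1+\kappa_2)$; moreover $\sup_k\|H_{x_k}\|<\infty$; * (relative error) $\|\Delta x_k-\Delta s_k\|\le\eta_k\|\Delta x_k\|$, where $\Delta x_k$ is the minimizer of $\lambda_{x_k,\omega_k}$; * (subgradient criterion) $\lambda_{x_k,\omega_k}(\Delta s_k)\le\min_{d\in X}\lambda^{\mu_k}_{x_k,\tilde\omega}(d)$, the minimum being attained, for some $\tilde\omega\in(0,\tilde\omega_{\max})$; * (sufficient decrease) $F(x_k+\Delta s_k)-F(x_k)\le\gamma\,\lambda_{x_k,\omega_k}(\Delta s_k)$. Assume that $(F(x_k))$ is bounded from below. Theorem. Let $f(x)=\hat f(x)+\check f(Kx)$, where $K:X\to Y$ is a compact linear operator into a normed space $Y$ and $\check f:Y\to\mathbb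 R$ is continuously differentiable. 1. Suppose that $(x_k)$, or a subsequence of it, converges weakly to $\bar x$, and that there is a convex neighborhood $U$ of $\bar x$ which contains all but finitely many members of this (sub)sequence (for example $U=X$, or any convex weak neighborhood of $\bar x$) such that $g+\hat f$ is convex and weakly lower semicontinuous on $U$. Then $\bar x$ is a stationary point of $F$. 2. If $F$ is strictly convex and radially unbounded ($F(x)\to\infty$ as $\|x\|\to\infty$), then $F$ has a unique minimizer $x_*$ and the whole sequence $(x_k)$ converges weakly to $x_*$. 3. If $F$ is $\kappa$-strongly convex for some $\kappa>0$, i.e. $F(sx+(1-s)y)\le sF(x)+(1-s)F(y)-\frac{\kappa}{2}s(1-s)\|x-y\|^2$ for all $x,y\in X$ and $s\in[0,1]$, then $F$ has a unique minimizer $x_*$ and $x_k\to x_*$ in norm. -/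

import Mathlib

open Filter Topology

namespace ProxNewton

section

variable {X : Type*} [NormedAddCommGroup X] [InnerProductSpace ℝ X]

/-- The Fréchet subdifferential of a real-valued function `Φ` at `x`: all `ℓ ∈ X*` with
`liminf_{y → x, y ≠ x} (Φ y - Φ x - ℓ (y - x)) / ‖y - x‖ ≥ 0`, written with an explicit `ε`. -/
def frechetSubdifferential (Φ : X → ℝ) (x : X) : Set (StrongDual ℝ X) :=
  {ℓ | ∀ ε : ℝ, 0 < ε → ∀ᶠ y in 𝓝 x, Φ x + ℓ (y - x) - ε * ‖y - x‖ ≤ Φ y}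

/-- `x` is a stationary point of `min Φ`. -/
def IsStationary (Φ : X → ℝ) (x : X) : Prop :=
  (0 : StrongDual ℝ X) ∈ frechetSubdifferential Φ x

/-- The regularized second order decrease model
`f'(x) d + (1/2) H_x(d, d) + (ω/2) ‖d‖² + g(x + d) - g(x)`. -/
noncomputable def decreaseModel (f g : X → ℝ) (Hx : X →L[ℝ] X →L[ℝ] ℝ) (x : X) (ω : ℝ) (d : X) :
    ℝ :=
  fderiv ℝ f x d + 1 / 2 * Hx d d + ω / 2 * ‖d‖ ^ 2 + g (x + d) - g x

/-- The subgradient model `f'(x) d + μ d + (ω/2) ‖d‖²`. -/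
noncomputable def subgradientModel (f : X → ℝ) (μ : StrongDual ℝ X) (x : X) (ω : ℝ) (d : X) : ℝ :=
  fderiv ℝ f x d + μ d + ω / 2 * ‖d‖ ^ 2

/-- `s` satisfies the relative error criterion `‖Δx(ω) - s‖ ≤ η ‖Δx(ω)‖`, where `Δx(ω)` is the
minimizer of the regularized second order decrease model at `x`. -/
def RelativeErrorCriterion (f g : X → ℝ) (Hx : X →L[ℝ] X →L[ℝ] ℝ) (x : X) (ω η : ℝ) (s : X) :
    Prop :=
  ∃ d : X, IsMinOn (decreaseModel f g Hx x ω) Set.univ d ∧ ‖d - s‖ ≤ η * ‖d‖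

/-- `s` satisfies the subgradient inexactness criterion: for some `ω'` with `0 < ω' < ωmax`, the
decrease model at `s` is at most the minimal value of the subgradient model with parameter `ω'`. -/
def SubgradientCriterion (f g : X → ℝ) (Hx : X →L[ℝ] X →L[ℝ] ℝ) (μ : StrongDual ℝ X) (x : X)
    (ω ωmax : ℝ) (s : X) : Prop :=
  ∃ ω' : ℝ, 0 < ω' ∧ ω' < ωmax ∧ ∃ d : X,
    IsMinOn (subgradientModel f μ x ω') Set.univ d ∧
      decreaseModel f g Hx x ω s ≤ subgradientModel f μ x ω' d

/-- `x` is a sequence of iterates of the globalized inexact Proximal Newton method for `f + g`: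
`ω k`, `η k`, `μ k` and `s k` are the regularization parameter, the forcing term, the subgradient
and the accepted inexact step of the `k`-th iteration. -/
structure IsInexactProxNewton (f g : X → ℝ) (H : X → X →L[ℝ] X →L[ℝ] ℝ) (γ ωmax : ℝ)
    (ω η : ℕ → ℝ) (μ : ℕ → StrongDual ℝ X) (s x : ℕ → X) : Prop where
  step : ∀ k, x (k + 1) = x k + s k
  forcing_nonneg : ∀ k, 0 ≤ η k
  relative_error : ∀ k, RelativeErrorCriterion f g (H (x k)) (x k) (ω k) (η k) (s k)
  subgradient_mem : ∀ k, μ k ∈ frechetSubdifferential g (x k)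
  subgradient_criterion : ∀ k,
    SubgradientCriterion f g (H (x k)) (μ k) (x k) (ω k) ωmax (s k)
  sufficient_decrease : ∀ k, (f (x k + s k) + g (x k + s k)) - (f (x k) + g (x k)) ≤
    γ * decreaseModel f g (H (x k)) (x k) (ω k) (s k)

/-- The sequence `u` converges weakly to `a`. -/
def WeaklyTendsto (u : ℕ → X) (a : X) : Prop :=
  Tendsto (fun k => toWeakSpace ℝ X (u k)) atTop (𝓝 (toWeakSpace ℝ X a))

/-- `Φ` is weakly lower semicontinuous on `U`. -/
def WeaklyLowerSemicontinuousOn (Φ : X → ℝ) (U : Set X) : Prop :=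
  LowerSemicontinuousOn (fun z : WeakSpace ℝ X => Φ ((toWeakSpace ℝ X).symm z))
    ((toWeakSpace ℝ X).symm ⁻¹' U)

end

end ProxNewton

/-! Put `r k = f'(x k) + μ k`, a Fréchet subgradient of `F = f + g` at `x k` by the sum rule. The
minimum of the subgradient model is `-‖r k‖² / (2ω')`, so the subgradient criterion and sufficient
decrease make `F` drop by at least `γ / (2ωmax) * ‖r k‖²` in each step. Since `F` is bounded below
along the iterates, `r k → 0`.

For convex functions Fréchet subgradients are global (`apply_add_le_of_uniformConvexOn`), which
turns `r k → 0` into the three claims. Weak limits: in the subgradient inequality of `g + fhat` at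
`x k`, the compactness of `K` makes the `fcheck` terms converge strongly, and weak lower
semicontinuity handles the remaining value. Strict convexity: the iterates stay in a bounded
sublevel set, so `F (x k)` tends to the minimum, and minimizing sequences converge weakly
(`exists_minimizer_weaklyTendsto`). Strong convexity: quadratic growth at the minimizer upgrades
convergence of values to norm convergence. -/

namespace ProxNewton

section

variable {X : Type*} [NormedAddCommGroup X] [InnerProductSpace ℝ X]

/-! ### Fréchet subgradients: convexity and the sum rule. -/

/-- A Fréchet subgradient of a uniformly convex function is a global subgradient. -/
theorem apply_add_le_of_uniformConvexOn {Φ : X → ℝ} {U : Set X} {φ : ℝ → ℝ}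
    (hΦ : UniformConvexOn U φ Φ) {x y : X} (hx : x ∈ U) (hy : y ∈ U) {ℓ : StrongDual ℝ X}
    (hℓ : ℓ ∈ frechetSubdifferential Φ x) : Φ x + ℓ (y - x) + φ ‖y - x‖ ≤ Φ y := by
  have key : ∀ ε : ℝ, 0 < ε → Φ x + ℓ (y - x) + φ ‖y - x‖ - ε * ‖y - x‖ ≤ Φ y := by
    intro ε hε
    -- Approach `x` along the segment to `y`: the convexity inequality at weight `t`, divided by
    -- `t`, keeps a factor `1 - t` on `φ`, which disappears as `t → 0`.
    have hline : Tendsto (fun t : ℝ => t • y + (1 - t) • x) (𝓝[>] 0) (𝓝 x) := by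
      have : Continuous fun t : ℝ => t • y + (1 - t) • x := by fun_prop
      simpa using (this.tendsto 0).mono_left nhdsWithin_le_nhds
    have hlim : Tendsto (fun t : ℝ => Φ x + ℓ (y - x) + (1 - t) * φ ‖y - x‖ - ε * ‖y - x‖)
        (𝓝[>] 0) (𝓝 (Φ x + ℓ (y - x) + φ ‖y - x‖ - ε * ‖y - x‖)) := by
      have : Continuous fun t : ℝ =>
          Φ x + ℓ (y - x) + (1 - t) * φ ‖y - x‖ - ε * ‖y - x‖ := by fun_prop
      simpa using (this.tendsto 0).mono_left nhdsWithin_le_nhds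
    refine le_of_tendsto hlim ?_
    filter_upwards [hline.eventually (hℓ ε hε), Ioo_mem_nhdsGT (zero_lt_one (α := ℝ))]
      with t ht ⟨ht0, ht1⟩
    have hsub : t • y + (1 - t) • x - x = t • (y - x) := by module
    rw [hsub, map_smul, norm_smul, Real.norm_of_nonneg ht0.le, smul_eq_mul] at ht
    have hc := hΦ.2 hy hx ht0.le (sub_nonneg.2 ht1.le) (by ring)
    simp only [smul_eq_mul] at hc
    refine le_of_mul_le_mul_left ?_ ht0
    linarith
  have hlim : Tendsto (fun ε : ℝ => Φ x + ℓ (y - x) + φ ‖y - x‖ - ε * ‖y - x‖)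
      (𝓝[>] 0) (𝓝 (Φ x + ℓ (y - x) + φ ‖y - x‖)) := by
    have : Continuous fun ε : ℝ => Φ x + ℓ (y - x) + φ ‖y - x‖ - ε * ‖y - x‖ := by fun_prop
    simpa using (this.tendsto 0).mono_left nhdsWithin_le_nhds
  exact le_of_tendsto hlim (eventually_mem_nhdsWithin.mono key)

theorem apply_add_le_of_convexOn {Φ : X → ℝ} {U : Set X} (hΦ : ConvexOn ℝ U Φ) {x y : X}
    (hx : x ∈ U) (hy : y ∈ U) {ℓ : StrongDual ℝ X} (hℓ : ℓ ∈ frechetSubdifferential Φ x) :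
    Φ x + ℓ (y - x) ≤ Φ y := by
  simpa using apply_add_le_of_uniformConvexOn (uniformConvexOn_zero.2 hΦ) hx hy hℓ

/-- The sum rule for the Fréchet subdifferential with one Fréchet differentiable summand. -/
theorem add_mem_frechetSubdifferential {Φ Ψ : X → ℝ} {x : X} {ℓ ψ : StrongDual ℝ X}
    (hΨ : HasFDerivAt Ψ ψ x) (hℓ : ℓ ∈ frechetSubdifferential Φ x) :
    ψ + ℓ ∈ frechetSubdifferential (fun z => Ψ z + Φ z) x := by
  intro ε hε
  filter_upwards [hℓ (ε / 2) (half_pos hε), hΨ.isLittleO.def (half_pos hε)] with y hy hy'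
  rw [Real.norm_eq_abs] at hy'
  have := (abs_le.1 hy').1
  simp only [add_apply]
  linarith

/-- A lower bound for `Φ - Ψ` by the affine function with slope `-Ψ' x` around `x` makes `x` a
stationary point of `Φ`. -/
theorem isStationary_of_eventually_le {Φ Ψ : X → ℝ} {x : X} {ψ : StrongDual ℝ X}
    (hΨ : HasFDerivAt Ψ ψ x) (h : ∀ᶠ y in 𝓝 x, Φ x - ψ (y - x) ≤ Φ y) :
    IsStationary (fun z => Ψ z + Φ z) x := by
  have hmem : -ψ ∈ frechetSubdifferential Φ x := by
    intro ε hε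
    filter_upwards [h] with y hy
    have := mul_nonneg hε.le (norm_nonneg (y - x))
    simp only [neg_apply]
    linarith
  simpa [IsStationary] using add_mem_frechetSubdifferential hΨ hmem

/-! ### Weak convergence and weak compactness. -/

theorem weaklyTendsto_iff {u : ℕ → X} {a : X} :
    WeaklyTendsto u a ↔ ∀ ℓ : StrongDual ℝ X, Tendsto (fun k => ℓ (u k)) atTop (𝓝 (ℓ a)) := by
  refine WeakBilin.tendsto_iff_forall_eval_tendsto (topDualPairing ℝ X).flip ?_
  intro v w hvw
  exact (SeparatingDual.eq_iff_forall_dual_eq (R := ℝ)).2 fun ℓ => LinearMap.congr_fun hvw ℓ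

/-- Weakly convergent sequences are bounded. -/
theorem WeaklyTendsto.exists_norm_le {u : ℕ → X} {a : X} (hu : WeaklyTendsto u a) :
    ∃ C, ∀ k, ‖u k‖ ≤ C := by
  -- Uniform boundedness is applied on the dual, which is complete even if `X` is not.
  obtain ⟨C, hC⟩ := banach_steinhaus (g := fun k => NormedSpace.inclusionInDoubleDual ℝ X (u k))
    fun ℓ => by
      obtain ⟨C, hC⟩ := (weaklyTendsto_iff.1 hu ℓ).norm.bddAbove_range
      exact ⟨C, fun k => hC ⟨k, rfl⟩⟩
  exact ⟨C, fun k => by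
    simpa using ((NormedSpace.inclusionInDoubleDualLi ℝ).norm_map (u k)).symm.trans_le (hC k)⟩

/-- Compact linear operators map weakly convergent sequences to convergent sequences. -/
theorem WeaklyTendsto.tendsto_of_isCompactOperator {Y : Type*} [NormedAddCommGroup Y]
    [NormedSpace ℝ Y] {K : X →L[ℝ] Y} (hK : IsCompactOperator K) {u : ℕ → X} {a : X}
    (hu : WeaklyTendsto u a) : Tendsto (fun k => K (u k)) atTop (𝓝 (K a)) := by
  obtain ⟨C, hC⟩ := hu.exists_norm_le
  obtain ⟨S, hS, hKS⟩ := IsCompactOperator.image_closedBall_subset_compact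
    (f := (K : X →ₗ[ℝ] Y)) hK C
  refine tendsto_of_subseq_tendsto fun ns hns => ?_
  obtain ⟨b, -, ms, hms, hb⟩ := hS.tendsto_subseq (x := fun k => K (u (ns k)))
    fun k => hKS ⟨u (ns k), by simpa using hC (ns k), rfl⟩
  have hab : b = K a := by
    refine (SeparatingDual.eq_iff_forall_dual_eq (R := ℝ)).2 fun ℓ => ?_
    exact tendsto_nhds_unique ((ℓ.continuous.tendsto b).comp hb)
      (((weaklyTendsto_iff.1 hu (ℓ.comp K)).comp hns).comp hms.tendsto_atTop)
  exact ⟨ms, hab ▸ hb⟩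

/-- Closed balls of a Hilbert space are weakly compact. -/
theorem isCompact_toWeakSpace_closedBall [CompleteSpace X] (r : ℝ) :
    IsCompact ((toWeakSpace ℝ X).symm ⁻¹' Metric.closedBall 0 r) := by
  -- The inverse Riesz map is weak-* to weak continuous, because by symmetry of the inner product
  -- each functional of `R m` is an evaluation of `m`; this transports Banach–Alaoglu.
  let R : WeakDual ℝ X → WeakSpace ℝ X := fun ℓ =>
    toWeakSpace ℝ X ((InnerProductSpace.toDual ℝ X).symm (WeakDual.toStrongDual ℓ))
  have hR : Continuous R := by
    refine WeakBilin.continuous_of_continuous_eval _ fun ℓ => ?_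
    have h : ∀ m : WeakDual ℝ X, (topDualPairing ℝ X).flip (R m) ℓ =
        m ((InnerProductSpace.toDual ℝ X).symm ℓ) := by
      intro m
      change ℓ ((InnerProductSpace.toDual ℝ X).symm (WeakDual.toStrongDual m)) = _
      rw [← InnerProductSpace.toDual_symm_apply (𝕜 := ℝ) (y := ℓ), real_inner_comm,
        InnerProductSpace.toDual_symm_apply]
      rfl
    simp only [h]
    exact WeakDual.eval_continuous _
  convert (WeakDual.isCompact_closedBall (𝕜 := ℝ) (0 : StrongDual ℝ X) r).image hR
  ext z
  constructor
  · intro hz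
    refine ⟨StrongDual.toWeakDual (InnerProductSpace.toDual ℝ X ((toWeakSpace ℝ X).symm z)), ?_, ?_⟩
    · simpa using hz
    · simp [R]
  · rintro ⟨ℓ, hℓ, rfl⟩
    simpa [R] using hℓ

/-- Convex lower semicontinuous functions are weakly lower semicontinuous. -/
theorem weaklyLowerSemicontinuous_of_convexOn {Φ : X → ℝ} (hconv : ConvexOn ℝ Set.univ Φ)
    (hlsc : LowerSemicontinuous Φ) :
    LowerSemicontinuous fun z : WeakSpace ℝ X => Φ ((toWeakSpace ℝ X).symm z) := by
  rw [lowerSemicontinuous_iff_isClosed_preimage]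
  intro c
  have hset : (fun z : WeakSpace ℝ X => Φ ((toWeakSpace ℝ X).symm z)) ⁻¹' Set.Iic c =
      toWeakSpace ℝ X '' closure (Φ ⁻¹' Set.Iic c) := by
    rw [(hlsc.isClosed_preimage c).closure_eq, LinearEquiv.image_eq_preimage_symm]
    rfl
  have hcvx : Convex ℝ (Φ ⁻¹' Set.Iic c) := by
    have hle : {y | y ∈ Set.univ ∧ Φ y ≤ c} = Φ ⁻¹' Set.Iic c := by
      ext y
      simp
    exact hle ▸ hconv.convex_le c
  -- Mazur: for a convex set the norm closure and the weak closure coincide.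
  rw [hset, hcvx.toWeakSpace_closure (𝕜 := ℝ)]
  exact isClosed_closure

/-! ### Minimizers and minimizing sequences of convex functions. -/

/-- A radially unbounded function is bounded only along bounded sequences. -/
theorem exists_norm_le_of_tendsto_cobounded {E : Type*} [NormedAddCommGroup E] {Φ : E → ℝ}
    (hcoer : Tendsto Φ (Bornology.cobounded E) atTop) (c : ℝ) :
    ∃ r, ∀ y, Φ y ≤ c → ‖y‖ ≤ r := by
  have h := hcoer.eventually_gt_atTop c
  rw [← comap_norm_atTop, eventually_comap] at h
  obtain ⟨r, hr⟩ := eventually_atTop.1 h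
  refine ⟨r, fun y hy => ?_⟩
  by_contra hlt
  exact (hr ‖y‖ (not_le.1 hlt).le y rfl).not_ge hy

/-- A strictly convex, lower semicontinuous, radially unbounded function on a Hilbert space has a
unique minimizer, and all minimizing sequences converge weakly to it. -/
theorem exists_minimizer_weaklyTendsto [CompleteSpace X] {Φ : X → ℝ}
    (hconv : StrictConvexOn ℝ Set.univ Φ) (hlsc : LowerSemicontinuous Φ)
    (hcoer : Tendsto Φ (Bornology.cobounded X) atTop) :
    ∃ xstar : X, (∀ y, y ≠ xstar → Φ xstar < Φ y) ∧
      ∀ u : ℕ → X, Tendsto (fun k => Φ (u k)) atTop (𝓝 (Φ xstar)) → WeaklyTendsto u xstar := by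
  have hw := weaklyLowerSemicontinuous_of_convexOn hconv.convexOn hlsc
  obtain ⟨r, hr⟩ := exists_norm_le_of_tendsto_cobounded hcoer (Φ 0)
  have hr0 : 0 ≤ r := by simpa using hr 0 le_rfl
  obtain ⟨a, -, hamin⟩ := LowerSemicontinuousOn.exists_isMinOn
    (s := (toWeakSpace ℝ X).symm ⁻¹' Metric.closedBall 0 r)
    ⟨0, by simpa using hr0⟩ (isCompact_toWeakSpace_closedBall r) (hw.lowerSemicontinuousOn _)
  set xstar := (toWeakSpace ℝ X).symm a with hxstar
  have hmin : ∀ y, Φ xstar ≤ Φ y := by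
    intro y
    by_cases hy : Φ y ≤ Φ 0
    · exact hamin (a := toWeakSpace ℝ X y) (by simpa using hr y hy)
    · exact (hamin (a := toWeakSpace ℝ X 0) (by simpa using hr0)).trans
        (by simpa using (not_le.1 hy).le)
  have hstrict : ∀ y, y ≠ xstar → Φ xstar < Φ y := by
    intro y hy
    refine (hmin y).lt_of_ne fun heq => hy ?_
    exact hconv.eq_of_isMinOn (fun z _ => heq ▸ hmin z) (fun z _ => hmin z)
      (Set.mem_univ y) (Set.mem_univ xstar)
  refine ⟨xstar, hstrict, fun u hu => ?_⟩
  obtain ⟨ρ, hρ⟩ := exists_norm_le_of_tendsto_cobounded hcoer (Φ xstar + 1)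
  refine tendsto_nhds.2 fun V hV hxV => ?_
  -- On the weakly compact part of the ball outside `V`, `Φ` attains a minimum above `Φ xstar`. Once
  -- `Φ (u k)` is below that value and below `Φ xstar + 1`, which keeps `u k` in the ball, `u k`
  -- must lie in `V`.
  set S : Set (WeakSpace ℝ X) := (toWeakSpace ℝ X).symm ⁻¹' Metric.closedBall 0 ρ \ V
  have hS : IsCompact S := (isCompact_toWeakSpace_closedBall ρ).diff hV
  have hgap : ∃ m, Φ xstar < m ∧ ∀ z ∈ S, m ≤ Φ ((toWeakSpace ℝ X).symm z) := by
    rcases S.eq_empty_or_nonempty with hS0 | hSne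
    · exact ⟨Φ xstar + 1, by linarith, by simp [hS0]⟩
    · obtain ⟨b, hb, hbmin⟩ :=
        LowerSemicontinuousOn.exists_isMinOn hSne hS (hw.lowerSemicontinuousOn _)
      refine ⟨_, hstrict ((toWeakSpace ℝ X).symm b) ?_, fun z hz => hbmin hz⟩
      rintro h
      exact hb.2 (by rwa [← h, LinearEquiv.apply_symm_apply] at hxV)
  obtain ⟨m, hm, hmS⟩ := hgap
  filter_upwards [hu.eventually_lt_const hm, hu.eventually_lt_const (lt_add_one (Φ xstar))]
    with k hk hk'
  by_contra hkV
  exact (hmS (toWeakSpace ℝ X (u k)) ⟨by simpa using hρ _ hk'.le, hkV⟩).not_gt (by simpa using hk)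

/-- The values of a convex function along a bounded sequence with vanishing subgradients converge
to its minimal value. -/
theorem tendsto_apply_of_subgradient_tendsto_zero {Φ : X → ℝ} (hconv : ConvexOn ℝ Set.univ Φ)
    {xstar : X} (hmin : ∀ y, Φ xstar ≤ Φ y) {u : ℕ → X} {ρ : ℝ} (hu : ∀ k, ‖u k‖ ≤ ρ)
    {r : ℕ → StrongDual ℝ X} (hr : ∀ k, r k ∈ frechetSubdifferential Φ (u k))
    (hr0 : Tendsto r atTop (𝓝 0)) : Tendsto (fun k => Φ (u k)) atTop (𝓝 (Φ xstar)) := by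
  have hupper : Tendsto (fun k => Φ xstar + ‖r k‖ * (‖xstar‖ + ρ)) atTop (𝓝 (Φ xstar)) := by
    simpa using (hr0.norm.mul_const (‖xstar‖ + ρ)).const_add (Φ xstar)
  refine tendsto_of_tendsto_of_tendsto_of_le_of_le tendsto_const_nhds hupper
    (fun k => hmin (u k)) fun k => ?_
  have hk := apply_add_le_of_convexOn hconv (Set.mem_univ (u k)) (Set.mem_univ xstar) (hr k)
  have habs := (abs_le.1 ((r k).le_opNorm (xstar - u k))).1
  have hnorm : ‖xstar - u k‖ ≤ ‖xstar‖ + ρ :=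
    (norm_sub_le _ _).trans (add_le_add_right (hu k) _)
  have := mul_le_mul_of_nonneg_left hnorm (norm_nonneg (r k))
  dsimp only
  linarith

/-- A strongly convex function with a Fréchet subgradient somewhere is radially unbounded. -/
theorem tendsto_cobounded_of_strongConvexOn {Φ : X → ℝ} {κ : ℝ} (hκ : 0 < κ)
    (hΦ : StrongConvexOn Set.univ κ Φ) {x : X} {ℓ : StrongDual ℝ X}
    (hℓ : ℓ ∈ frechetSubdifferential Φ x) : Tendsto Φ (Bornology.cobounded X) atTop := by
  have hnorm : Tendsto (fun y => ‖y - x‖) (Bornology.cobounded X) atTop := by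
    refine tendsto_atTop_mono (fun y => norm_sub_norm_le y x) ?_
    exact tendsto_atTop_add_const_right _ _ tendsto_norm_cobounded_atTop
  -- With `t = ‖y - x‖`, the strong subgradient inequality bounds `Φ y` below by `Φ x + t * (κ / 2 *
  -- t - ‖ℓ‖)`.
  have hlin : Tendsto (fun t : ℝ => κ / 2 * t - ‖ℓ‖) atTop atTop :=
    tendsto_atTop_add_const_right _ _ (tendsto_id.const_mul_atTop (half_pos hκ))
  have hquad : Tendsto (fun t : ℝ => Φ x + t * (κ / 2 * t - ‖ℓ‖)) atTop atTop :=
    tendsto_atTop_add_const_left _ _ (tendsto_id.atTop_mul_atTop₀ hlin)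
  refine tendsto_atTop_mono (fun y => ?_) (hquad.comp hnorm)
  have hy := apply_add_le_of_uniformConvexOn hΦ (Set.mem_univ x) (Set.mem_univ y) hℓ
  have habs := (abs_le.1 (ℓ.le_opNorm (y - x))).1
  simp only [Function.comp_apply]
  linarith

/-! ### Decrease along the iterates. -/

/-- A lower bound for the minimal value of the subgradient model. -/
theorem subgradientModel_le_of_isMinOn [CompleteSpace X] {f : X → ℝ} {μ : StrongDual ℝ X} {x d : X}
    {ω : ℝ} (hω : 0 < ω) (hd : IsMinOn (subgradientModel f μ x ω) Set.univ d) :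
    subgradientModel f μ x ω d ≤ -(‖fderiv ℝ f x + μ‖ ^ 2 / (2 * ω)) := by
  set r := fderiv ℝ f x + μ with hr
  set v := (InnerProductSpace.toDual ℝ X).symm r with hv
  have hrv : r v = ‖r‖ ^ 2 := by
    rw [← InnerProductSpace.toDual_symm_apply (𝕜 := ℝ) (y := r), real_inner_self_eq_norm_sq,
      LinearIsometryEquiv.norm_map]
  have hnv : ‖v‖ = ‖r‖ := LinearIsometryEquiv.norm_map _ _
  -- The quadratic model is tested at its exact minimizer, the Riesz gradient scaled by `-ω⁻¹`.
  refine (hd (Set.mem_univ (-(ω⁻¹ • v)))).trans_eq ?_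
  have h1 : fderiv ℝ f x (-(ω⁻¹ • v)) + μ (-(ω⁻¹ • v)) = -(ω⁻¹ * ‖r‖ ^ 2) := by
    rw [← add_apply, ← hr, map_neg, map_smul, hrv, smul_eq_mul]
  simp only [subgradientModel]
  rw [h1, norm_neg, norm_smul, hnv, Real.norm_of_nonneg (inv_nonneg.2 hω.le)]
  field_simp
  ring

/-- If a sequence that is bounded below decreases in each step by at least a fixed multiple of
`‖r k‖ ^ 2`, then `r k → 0`. -/
theorem tendsto_zero_of_sq_norm_le_decrease {E : Type*} [NormedAddCommGroup E] {a : ℕ → ℝ}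
    {r : ℕ → E} {c : ℝ} (hc : 0 < c) (ha : BddBelow (Set.range a))
    (h : ∀ k, c * ‖r k‖ ^ 2 ≤ a k - a (k + 1)) : Tendsto r atTop (𝓝 0) := by
  have hanti : Antitone a := antitone_nat_of_succ_le fun k => by
    have := mul_nonneg hc.le (sq_nonneg ‖r k‖)
    linarith [h k]
  have hlim := tendsto_atTop_ciInf hanti ha
  have hdiff : Tendsto (fun k => c⁻¹ * (a k - a (k + 1))) atTop (𝓝 0) := by
    simpa using (hlim.sub (hlim.comp (tendsto_add_atTop_nat 1))).const_mul c⁻¹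
  have hsq : Tendsto (fun k => ‖r k‖ ^ 2) atTop (𝓝 0) :=
    squeeze_zero (fun k => sq_nonneg _) (fun k => (le_inv_mul_iff₀ hc).2 (h k)) hdiff
  rw [tendsto_zero_iff_norm_tendsto_zero]
  simpa using hsq.sqrt

namespace IsInexactProxNewton

variable {f g : X → ℝ} {H : X → X →L[ℝ] X →L[ℝ] ℝ} {γ ωmax : ℝ} {ω η : ℕ → ℝ}
  {μ : ℕ → StrongDual ℝ X} {s x : ℕ → X}

/-- The parameter `ω'` of the criterion varies with `k`; replacing it by its bound `ωmax` makes the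
decrease constant uniform, so that the decreases can force `r k → 0`. -/
theorem decrease [CompleteSpace X] (hx : IsInexactProxNewton f g H γ ωmax ω η μ s x) (hγ : 0 < γ)
    (k : ℕ) : γ / (2 * ωmax) * ‖fderiv ℝ f (x k) + μ k‖ ^ 2 ≤
      (f (x k) + g (x k)) - (f (x (k + 1)) + g (x (k + 1))) := by
  obtain ⟨ω', hω', hlt, d, hd, hsd⟩ := hx.subgradient_criterion k
  have hmodel := hsd.trans (subgradientModel_le_of_isMinOn hω' hd)
  have hdec := hx.sufficient_decrease k
  rw [← hx.step k] at hdec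
  have hmono : ‖fderiv ℝ f (x k) + μ k‖ ^ 2 / (2 * ωmax) ≤
      ‖fderiv ℝ f (x k) + μ k‖ ^ 2 / (2 * ω') := by gcongr
  have := mul_le_mul_of_nonneg_left (hmodel.trans (neg_le_neg hmono)) hγ.le
  have heq : γ / (2 * ωmax) * ‖fderiv ℝ f (x k) + μ k‖ ^ 2 =
      γ * (‖fderiv ℝ f (x k) + μ k‖ ^ 2 / (2 * ωmax)) := by ring
  linarith

theorem apply_le_apply_zero [CompleteSpace X] (hx : IsInexactProxNewton f g H γ ωmax ω η μ s x)
    (hγ : 0 < γ) (hωmax : 0 < ωmax) (k : ℕ) : f (x k) + g (x k) ≤ f (x 0) + g (x 0) := by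
  have hanti : Antitone fun k => f (x k) + g (x k) := antitone_nat_of_succ_le fun k => by
    have : 0 ≤ γ / (2 * ωmax) * ‖fderiv ℝ f (x k) + μ k‖ ^ 2 := by positivity
    linarith [hx.decrease hγ k]
  exact hanti (Nat.zero_le k)

theorem tendsto_subgradient_zero [CompleteSpace X]
    (hx : IsInexactProxNewton f g H γ ωmax ω η μ s x) (hγ : 0 < γ) (hωmax : 0 < ωmax)
    (hbelow : BddBelow (Set.range fun k => f (x k) + g (x k))) :
    Tendsto (fun k => fderiv ℝ f (x k) + μ k) atTop (𝓝 0) :=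
  tendsto_zero_of_sq_norm_le_decrease (by positivity : 0 < γ / (2 * ωmax)) hbelow
    (hx.decrease hγ)

end IsInexactProxNewton

/-! ### Stationarity of weak limits. -/

/-- Weak limits of sequences with vanishing subgradients are stationary. -/
theorem isStationary_of_weaklyTendsto {Y : Type*} [NormedAddCommGroup Y] [NormedSpace ℝ Y]
    {K : X →L[ℝ] Y} (hK : IsCompactOperator K) {Ψ : Y → ℝ} (hΨ : ContDiff ℝ 1 Ψ) {h : X → ℝ}
    {U : Set X} (hconv : ConvexOn ℝ U h) (hlsc : WeaklyLowerSemicontinuousOn h U) {u : ℕ → X}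
    {a : X} (hU : U ∈ 𝓝 a) (huU : ∀ᶠ j in atTop, u j ∈ U) (hu : WeaklyTendsto u a)
    {r : ℕ → StrongDual ℝ X}
    (hr : ∀ j, r j - (fderiv ℝ Ψ (K (u j))).comp K ∈ frechetSubdifferential h (u j))
    (hr0 : Tendsto r atTop (𝓝 0)) : IsStationary (fun z => Ψ (K z) + h z) a := by
  have hdiff := hΨ.differentiable one_ne_zero
  have hΨa : HasFDerivAt (fun z => Ψ (K z)) ((fderiv ℝ Ψ (K a)).comp K) a :=
    (hdiff (K a)).hasFDerivAt.comp a K.hasFDerivAt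
  refine isStationary_of_eventually_le hΨa (mem_of_superset hU fun y hy => ?_)
  have hKu := hu.tendsto_of_isCompactOperator hK
  obtain ⟨C, hC⟩ := hu.exists_norm_le
  have hrlim : Tendsto (fun j => r j (y - u j)) atTop (𝓝 0) := by
    refine squeeze_zero_norm (fun j => ?_)
      (by simpa using hr0.norm.mul_const (‖y‖ + C) : Tendsto (fun j => ‖r j‖ * (‖y‖ + C)) _ _)
    refine ((r j).le_opNorm _).trans (mul_le_mul_of_nonneg_left ?_ (norm_nonneg _))
    exact (norm_sub_le _ _).trans (add_le_add_right (hC j) _)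
  have hΨlim : Tendsto (fun j => fderiv ℝ Ψ (K (u j)) (K y - K (u j))) atTop
      (𝓝 (fderiv ℝ Ψ (K a) (K y - K a))) := by
    have hd : Tendsto (fun j => fderiv ℝ Ψ (K (u j))) atTop (𝓝 (fderiv ℝ Ψ (K a))) :=
      ((hΨ.continuous_fderiv one_ne_zero).tendsto _).comp hKu
    exact (isBoundedBilinearMap_apply (𝕜 := ℝ) (E := Y) (F := ℝ)).continuous.tendsto _ |>.comp
      (hd.prodMk_nhds (tendsto_const_nhds.sub hKu))
  have hlim : Tendsto (fun j => h y - r j (y - u j) + fderiv ℝ Ψ (K (u j)) (K y - K (u j))) atTop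
      (𝓝 (h y + fderiv ℝ Ψ (K a) (K y - K a))) := by
    simpa using (tendsto_const_nhds (x := h y)).sub hrlim |>.add hΨlim
  have hub : h a ≤ h y + fderiv ℝ Ψ (K a) (K y - K a) := by
    -- Lower semicontinuity gives `c' < h (u j)` eventually for each `c' < h a`. The limit keeps
    -- only `≤`, so the gap `c < c'` restores strictness.
    refine le_of_forall_lt fun c hc => ?_
    obtain ⟨c', hcc', hc'⟩ := exists_between hc
    refine hcc'.trans_le (ge_of_tendsto hlim ?_)
    have hwithin : Tendsto (fun j => toWeakSpace ℝ X (u j)) atTop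
        (𝓝[(toWeakSpace ℝ X).symm ⁻¹' U] (toWeakSpace ℝ X a)) :=
      tendsto_nhdsWithin_iff.2 ⟨hu, by simpa using huU⟩
    have hev := hwithin.eventually
      (hlsc (toWeakSpace ℝ X a) (by simpa using mem_of_mem_nhds hU) c' (by simpa using hc'))
    filter_upwards [hev, huU] with j hj hjU
    have hsub := apply_add_le_of_convexOn hconv hjU hy (hr j)
    simp only [sub_apply, ContinuousLinearMap.comp_apply, map_sub K] at hsub
    simp only [LinearEquiv.symm_apply_apply] at hj
    linarith
  simp only [Set.mem_ofPred_eq, ContinuousLinearMap.comp_apply, map_sub K]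
  linarith

end

end ProxNewton

/-! ### The three convergence statements. -/

theorem mainTheorem3
    {X : Type*} [NormedAddCommGroup X] [InnerProductSpace ℝ X] [CompleteSpace X]
    {Y : Type*} [NormedAddCommGroup Y] [NormedSpace ℝ Y]
    -- the smooth part and its splitting
    (f fhat : X → ℝ) (fcheck : Y → ℝ) (K : X →L[ℝ] Y)
    (hf : ContDiff ℝ 1 f) (hfLip : ∃ L : NNReal, LipschitzWith L (fderiv ℝ f))
    (hfcheck : ContDiff ℝ 1 fcheck) (hK : IsCompactOperator K)
    (hsplit : ∀ x, f x = fhat x + fcheck (K x))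
    -- the non-smooth part; `κ₂` may be negative
    (g : X → ℝ) (κ₂ : ℝ) (hglsc : LowerSemicontinuous g) (hg : StrongConvexOn Set.univ κ₂ g)
    -- the iterates
    (H : X → X →L[ℝ] X →L[ℝ] ℝ) (γ ωmax : ℝ) (hγ : 0 < γ) (hγ' : γ < 1) (hωmax : 0 < ωmax)
    (ω η : ℕ → ℝ) (μ : ℕ → StrongDual ℝ X) (s x : ℕ → X)
    (hHsymm : ∀ k v w, H (x k) v w = H (x k) w v)
    (hHbdd : ∃ M : ℝ, ∀ k, ‖H (x k)‖ ≤ M)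
    (hω : ∀ k, ∃ κ₁ : ℝ, (∀ v, κ₁ * ‖v‖ ^ 2 ≤ H (x k) v v) ∧ -(κ₁ + κ₂) < ω k)
    (hx : ProxNewton.IsInexactProxNewton f g H γ ωmax ω η μ s x)
    (hbelow : BddBelow (Set.range fun k => f (x k) + g (x k))) :
    -- weak limits (also of subsequences) are stationary
    (∀ (φ : ℕ → ℕ) (xbar : X), StrictMono φ →
      ProxNewton.WeaklyTendsto (fun j => x (φ j)) xbar →
      (∃ U : Set X, U ∈ 𝓝 xbar ∧ (∀ᶠ j in atTop, x (φ j) ∈ U) ∧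
        ConvexOn ℝ U (fun z => g z + fhat z) ∧
        ProxNewton.WeaklyLowerSemicontinuousOn (fun z => g z + fhat z) U) →
      ProxNewton.IsStationary (fun z => f z + g z) xbar) ∧
    -- the strictly convex, radially unbounded case
    (StrictConvexOn ℝ Set.univ (fun z => f z + g z) →
      Tendsto (fun z => f z + g z) (Bornology.cobounded X) atTop →
      ∃ xstar : X, (∀ y, y ≠ xstar → f xstar + g xstar < f y + g y) ∧
        ProxNewton.WeaklyTendsto x xstar) ∧
    -- the strongly convex case
    (∀ κ : ℝ, 0 < κ → StrongConvexOn Set.univ κ (fun z => f z + g z) →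
      ∃ xstar : X, (∀ y, y ≠ xstar → f xstar + g xstar < f y + g y) ∧
        Tendsto x atTop (𝓝 xstar)) := by
  have hfd : ∀ z, HasFDerivAt f (fderiv ℝ f z) z := fun z =>
    (hf.differentiable one_ne_zero z).hasFDerivAt
  have hr0 := hx.tendsto_subgradient_zero hγ hωmax hbelow
  have hrmem : ∀ k, fderiv ℝ f (x k) + μ k ∈
      ProxNewton.frechetSubdifferential (fun z => f z + g z) (x k) := fun k =>
    ProxNewton.add_mem_frechetSubdifferential (hfd _) (hx.subgradient_mem k)
  have hlsc : LowerSemicontinuous fun z => f z + g z := hf.continuous.lowerSemicontinuous.add hglsc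
  have hmain : StrictConvexOn ℝ Set.univ (fun z => f z + g z) →
      Tendsto (fun z => f z + g z) (Bornology.cobounded X) atTop →
      ∃ xstar : X, (∀ y, y ≠ xstar → f xstar + g xstar < f y + g y) ∧
        ProxNewton.WeaklyTendsto x xstar ∧
        Tendsto (fun k => f (x k) + g (x k)) atTop (𝓝 (f xstar + g xstar)) := by
    intro hconv hcoer
    obtain ⟨xstar, hmin, hweak⟩ := ProxNewton.exists_minimizer_weaklyTendsto hconv hlsc hcoer
    obtain ⟨ρ, hρ⟩ := ProxNewton.exists_norm_le_of_tendsto_cobounded hcoer (f (x 0) + g (x 0))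
    have hval := ProxNewton.tendsto_apply_of_subgradient_tendsto_zero hconv.convexOn
      (xstar := xstar) (fun y => by
        rcases eq_or_ne y xstar with rfl | hy
        exacts [le_rfl, (hmin y hy).le])
      (fun k => hρ _ (hx.apply_le_apply_zero hγ hωmax k)) hrmem hr0
    exact ⟨xstar, hmin, hweak x hval, hval⟩
  refine ⟨?_, ?_, ?_⟩
  · rintro φ xbar hφ hweak ⟨U, hU, hxU, hconv, hwlsc⟩
    have hF : (fun z => f z + g z) = fun z => fcheck (K z) + (g z + fhat z) := by
      funext z
      rw [hsplit z]
      ring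
    -- Differentiability of `fhat` is not assumed but follows from `fhat = f - fcheck ∘ K`, so the
    -- sum rule applies to `g + fhat`.
    have hh : (fun z => g z + fhat z) = fun z => (f z - fcheck (K z)) + g z := by
      funext z
      rw [hsplit z]
      ring
    rw [hF]
    refine ProxNewton.isStationary_of_weaklyTendsto hK hfcheck hconv hwlsc hU hxU hweak
      (fun j => ?_) (hr0.comp hφ.tendsto_atTop)
    have hd : HasFDerivAt (fun z => f z - fcheck (K z))
        (fderiv ℝ f (x (φ j)) - (fderiv ℝ fcheck (K (x (φ j)))).comp K) (x (φ j)) :=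
      (hfd _).sub ((hfcheck.differentiable one_ne_zero _).hasFDerivAt.comp _ K.hasFDerivAt)
    rw [hh]
    convert ProxNewton.add_mem_frechetSubdifferential hd (hx.subgradient_mem (φ j)) using 1
    simp only [Function.comp_apply]
    abel
  · intro hconv hcoer
    obtain ⟨xstar, hmin, hweak, -⟩ := hmain hconv hcoer
    exact ⟨xstar, hmin, hweak⟩
  · intro κ hκ hconv
    -- Radial unboundedness comes from strong convexity and the subgradient at `x 0`.
    obtain ⟨xstar, hmin, -, hval⟩ := hmain (hconv.strictConvexOn hκ)
      (ProxNewton.tendsto_cobounded_of_strongConvexOn hκ hconv (hrmem 0))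
    refine ⟨xstar, hmin, ?_⟩
    have hzero : (0 : StrongDual ℝ X) ∈
        ProxNewton.frechetSubdifferential (fun z => f z + g z) xstar := by
      intro ε hε
      refine Eventually.of_forall fun y => ?_
      have hnn := mul_nonneg hε.le (norm_nonneg (y - xstar))
      have hle : f xstar + g xstar ≤ f y + g y := by
        rcases eq_or_ne y xstar with rfl | hy
        exacts [le_rfl, (hmin y hy).le]
      simp only [zero_apply]
      linarith
    -- Quadratic growth: the strong subgradient inequality at `xstar` with subgradient `0`.
    have hgrowth : ∀ k, ‖x k - xstar‖ ^ 2 ≤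
        2 / κ * ((f (x k) + g (x k)) - (f xstar + g xstar)) := by
      intro k
      have hk := ProxNewton.apply_add_le_of_uniformConvexOn hconv (Set.mem_univ xstar)
        (Set.mem_univ (x k)) hzero
      simp only [zero_apply] at hk
      rw [div_mul_eq_mul_div, le_div_iff₀ hκ]
      linarith
    have hsq : Tendsto (fun k => ‖x k - xstar‖ ^ 2) atTop (𝓝 0) :=
      squeeze_zero (fun k => sq_nonneg _) hgrowth
        (by simpa using (hval.sub_const (f xstar + g xstar)).const_mul (2 / κ))
    rw [tendsto_iff_norm_sub_tendsto_zero]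
    simpa using hsq.sqrt
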